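/- Let $n\ge 5$. Let $\Delta=|\Lambda(\mathbb F_2^{n-1})|$ be the spherical building associated to $\mathbb F_2^{n-1}$: its vertices are the linear subspaces $U$ of $\mathbb F_2^{n-1}$ with $0\neq U\neq\mathbb F_2^{n-1}$, and its simplices are the finite non-empty chains of such subspaces under inclusion. Equip $\Delta$ with its natural spherical metric: apply to each closed simplex the rank-preserving identification with a face of a chamber of the Coxeter complex of $S_{n-1}$ (the unit sphere of $\{x\in\mathbb R^{n-1}:\sum_k x_k=0\}$, triangulated by the hyperplanes $x_k=x_l$), give the simplex the angular metric of that sphere, and let $\Delta$ carry the induced length metric. Let $e_1,\dots,e_{n-1}$ be the standard basis of $\mathbb F_2^{n-1}$ and put $e_n=0$. Let $\mathrm{NCP}_n$ be the set of non-crossing partitions of $\{1,\dots,n\}$, that is, of the partitions for which there are no $a<b<c<d$ with $a,c$ in one block and $b,d$ in a different block. Identify $\pi\in\mathrm{NCP}_n$ with the subspace of $\mathbb F_2^{n-1}$ spanned by all $e_i+e_j$ such that $i<j$ lie in a common block of $\pi$. Let $|\mathrm{NCP}_n|\subseteq\Delta$ be the subcomplex consisting of all simplices whose vertices are all non-crossing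 partitions. **Theorem.** Let $p$ be a vertex of $\Delta$ that is not contained in $|\mathrm{NCP}_n|$. Then there exists a geodesic $\gamma\colon[0,\pi]\to\Delta$ (an isometry onto its image, so of length $\pi$) with $p\in\gamma$ and $\gamma\cap|\mathrm{NCP}_n|=\emptyset$. Moreover, $\gamma$ can be chosen as the concatenation of three edges of $\Delta$, from a vertex $p_u$ to $p$, from $p$ to a vertex $q$, and from $q$ to a vertex $p_v$. -/

import Mathlib

noncomputable section

/-! ## The spherical building of linear subspaces of `𝔽₂ⁿ⁻¹` as a simplicial complex -/

/-- The vector space `𝔽₂ⁿ⁻¹`. -/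
abbrev FTwoSpace (n : ℕ) : Type := Fin (n - 1) → ZMod 2

/-- The vertices of the building `Δ`: the elements of the lattice of linear subspaces of `𝔽₂ⁿ⁻¹`
other than its minimum and its maximum, ordered by inclusion. -/
abbrev BuildingVertex (n : ℕ) : Type :=
  {U : Submodule (ZMod 2) (FTwoSpace n) // U ≠ ⊥ ∧ U ≠ ⊤}

/-- The rank of a vertex is the dimension of the subspace. -/
def BuildingVertex.rank {n : ℕ} (U : BuildingVertex n) : ℕ :=
  Module.finrank (ZMod 2) U.1

/-- The building `Δ = |Λ(𝔽₂ⁿ⁻¹)|`: the order complex of the lattice of linear subspaces. The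
simplices are the non-empty finite chains of proper non-zero subspaces. -/
def buildingComplex (n : ℕ) : AbstractSimplicialComplex (BuildingVertex n) where
  faces := {σ | σ.Nonempty ∧ IsChain (· ≤ ·) (σ : Set (BuildingVertex n))}
  isRelLowerSet_faces := fun _ hσ =>
    ⟨hσ.1, fun _ hτσ hτ => ⟨hτ, hσ.2.mono (Finset.coe_subset.mpr hτσ)⟩⟩
  singleton_mem := fun v => ⟨Finset.singleton_nonempty v, by simp⟩

/-- Two vertices of `Δ` are joined by an edge of `Δ`. -/
def BuildingVertex.Adjacent {n : ℕ} (U U' : BuildingVertex n) : Prop := U < U' ∨ U' < U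

/-! ## Non-crossing partitions and their embedding -/

/-- A partition of `{1, …, n}`, given as an equivalence relation on `Fin n` whose classes are the
blocks, is non-crossing if there are no `a < b < c < d` such that `a, c` lie in one block and
`b, d` lie in a different block. -/
def IsNonCrossing {n : ℕ} (P : Setoid (Fin n)) : Prop :=
  ¬ ∃ a b c d : Fin n, a < b ∧ b < c ∧ c < d ∧ P a c ∧ P b d ∧ ¬ P a b

/-- The standard basis vectors `e₁, …, eₙ₋₁` of `𝔽₂ⁿ⁻¹`, supplemented by `eₙ = 0`
(the label `k` of the `n`-gon is the element `k - 1` of `Fin n`). -/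
def edgeBasisVector (n : ℕ) (i : Fin n) : FTwoSpace n :=
  fun k => if (k : ℕ) = (i : ℕ) then 1 else 0

/-- The rank one subspace of an edge `(i, j)` of the `n`-gon, `i < j`: it is `⟨eᵢ + eⱼ⟩` if
`j < n`, and `⟨eᵢ⟩` if `j = n`. -/
def edgeSubspace (n : ℕ) (i j : Fin n) : Submodule (ZMod 2) (FTwoSpace n) :=
  Submodule.span (ZMod 2) {edgeBasisVector n i + edgeBasisVector n j}

/-- The embedding of the partition lattice into the lattice of linear subspaces: a partition is
mapped to the join of the subspaces of its edges. By `iSup_edgeSubspace_eq` below it is enough to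
take the edges of an arbitrary spanning forest of the partition. -/
def partitionSubspace {n : ℕ} (P : Setoid (Fin n)) : Submodule (ZMod 2) (FTwoSpace n) :=
  ⨆ (i : Fin n) (j : Fin n) (_ : i < j ∧ P i j), edgeSubspace n i j

theorem FTwoSpace.add_self {n : ℕ} (v : FTwoSpace n) : v + v = 0 := by
  funext k
  exact CharTwo.add_self_eq_zero (v k)

theorem edgeSubspace_comm {n : ℕ} (i j : Fin n) : edgeSubspace n i j = edgeSubspace n j i := by
  unfold edgeSubspace
  rw [add_comm]

theorem edgeSubspace_self {n : ℕ} (i : Fin n) : edgeSubspace n i i = ⊥ := by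
  unfold edgeSubspace
  rw [FTwoSpace.add_self, Submodule.span_zero_singleton]

theorem edgeSubspace_le_sup {n : ℕ} (i j k : Fin n) :
    edgeSubspace n i k ≤ edgeSubspace n i j ⊔ edgeSubspace n j k := by
  unfold edgeSubspace
  rw [Submodule.span_singleton_le_iff_mem]
  have h : edgeBasisVector n i + edgeBasisVector n k
      = (edgeBasisVector n i + edgeBasisVector n j)
        + (edgeBasisVector n j + edgeBasisVector n k) := by
    have := FTwoSpace.add_self (edgeBasisVector n j)
    calc edgeBasisVector n i + edgeBasisVector n k
        = edgeBasisVector n i + 0 + edgeBasisVector n k := by rw [add_zero]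
      _ = _ := by rw [← this]; abel
  rw [h]
  exact Submodule.add_mem_sup (Submodule.mem_span_singleton_self _)
    (Submodule.mem_span_singleton_self _)

/-- If a set `A` of edges generates the partition `P`, that is, if the blocks of `P` are the
connected components of the graph with edge set `A`, then the image of `P` is the join of the
subspaces of the edges in `A`. -/
theorem iSup_edgeSubspace_eq {n : ℕ} (A : Set (Fin n × Fin n)) :
    ⨆ a ∈ A, edgeSubspace n a.1 a.2
      = partitionSubspace (Relation.EqvGen.setoid fun i j => (i, j) ∈ A) := by
  apply le_antisymm
  · refine iSup₂_le fun a ha => ?_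
    have hP : (Relation.EqvGen.setoid fun i j => (i, j) ∈ A) a.1 a.2 :=
      Relation.EqvGen.rel _ _ ha
    rcases lt_trichotomy a.1 a.2 with h | h | h
    · exact le_iSup_of_le a.1 (le_iSup_of_le a.2 (le_iSup_of_le ⟨h, hP⟩ le_rfl))
    · rw [h, edgeSubspace_self]
      exact bot_le
    · rw [edgeSubspace_comm]
      exact le_iSup_of_le a.2 (le_iSup_of_le a.1
        (le_iSup_of_le ⟨h, Relation.EqvGen.symm _ _ hP⟩ le_rfl))
  · refine iSup_le fun i => iSup_le fun j => iSup_le fun h => ?_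
    have h2 : Relation.EqvGen (fun i j => (i, j) ∈ A) i j := h.2
    clear h
    induction h2 with
    | rel x y hxy => exact le_iSup₂_of_le (x, y) hxy le_rfl
    | refl x => rw [edgeSubspace_self]; exact bot_le
    | symm x y _ ih => rw [edgeSubspace_comm]; exact ih
    | trans x y z _ _ ih1 ih2 => exact (edgeSubspace_le_sup x y z).trans (sup_le ih1 ih2)

/-- A vertex of `Δ` is a non-crossing partition if it is the image of one. -/
def BuildingVertex.IsNCP {n : ℕ} (U : BuildingVertex n) : Prop :=
  ∃ P : Setoid (Fin n), IsNonCrossing P ∧ partitionSubspace P = U.1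

/-- The non-crossing partition complex `|NCPₙ|` as the induced subcomplex of the building `Δ`
spanned by the vertices that are non-crossing partitions. -/
def ncpComplex (n : ℕ) : PreAbstractSimplicialComplex (BuildingVertex n) where
  faces := {σ | σ ∈ (buildingComplex n).faces ∧ ∀ U ∈ σ, U.IsNCP}
  isRelLowerSet_faces := fun _ hσ =>
    ⟨hσ.1.1, fun _ hτσ hτ =>
      ⟨((buildingComplex n).isRelLowerSet_faces hσ.1).2 hτσ hτ, fun U hU => hσ.2 U (hτσ hU)⟩⟩

/-! ## The spherical realization of the building and its length metric -/

/-- The points of the realization of `Δ`, in barycentric coordinates: functions with non-negative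
values, whose support is a simplex, and whose values add up to `1`. -/
structure Building (n : ℕ) where
  weight : BuildingVertex n →₀ ℝ
  weight_nonneg : ∀ U, 0 ≤ weight U
  support_mem : weight.support ∈ (buildingComplex n).faces
  sum_weight : (weight.sum fun _ c => c) = 1

namespace Building

variable {n : ℕ}

/-- A vertex, as a point of the realization. -/
def ofVertex (U : BuildingVertex n) : Building n where
  weight := Finsupp.single U 1
  weight_nonneg := fun U' => by
    classical
    rw [Finsupp.single_apply]
    split_ifs <;> norm_num
  support_mem := by
    rw [Finsupp.support_single U one_ne_zero]
    exact (buildingComplex n).singleton_mem U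
  sum_weight := by simp

/-- The closed edge spanned by two adjacent vertices. -/
def edge (U U' : BuildingVertex n) : Set (Building n) :=
  {x | ∀ V ∈ x.weight.support, V = U ∨ V = U'}

/-- The points of the realization of the non-crossing partition complex. -/
def ncp (n : ℕ) : Set (Building n) := {x | x.weight.support ∈ (ncpComplex n).faces}

/-- The vector on the ray of the rank `i` vertex of the fundamental chamber
`x₁ ≥ x₂ ≥ ⋯ ≥ xₙ₋₁` of the Coxeter group `Sₙ₋₁`, which acts by permutation of the coordinates on
the Euclidean space of vectors in `ℝⁿ⁻¹` with coordinate sum zero: the orthogonal projection of the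
indicator vector of the first `i` coordinates. -/
def chamberVector (n i : ℕ) : EuclideanSpace ℝ (Fin (n - 1)) :=
  WithLp.toLp 2 fun k => (if (k : ℕ) < i then 1 else 0) - (i : ℝ) / ((n - 1 : ℕ) : ℝ)

/-- The chart that maps every closed simplex of `Δ` to the corresponding face of the fundamental
chamber of the Coxeter complex, by preserving the ranks of the vertices; the point of the unit
sphere is the one on the ray through this vector. -/
def chart (x : Building n) : EuclideanSpace ℝ (Fin (n - 1)) :=
  x.weight.sum fun U c => c • chamberVector n U.rank

/-- Two points lie in a common closed simplex. -/
def InCommonSimplex (x y : Building n) : Prop :=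
  ∃ σ ∈ (buildingComplex n).faces, x.weight.support ⊆ σ ∧ y.weight.support ⊆ σ

/-- The spherical distance of two points of a common closed simplex. -/
def simplexDist (x y : Building n) : ℝ := InnerProductGeometry.angle (chart x) (chart y)

/-- There is a broken path `x = x₀, x₁, …, xₘ = y` of length `l`, in which any two consecutive
points lie in a common closed simplex and are joined by the spherical segment in it. -/
inductive HasBrokenPath : Building n → Building n → ENNReal → Prop
  | refl (x : Building n) : HasBrokenPath x x 0
  | step {x y z : Building n} {l : ENNReal} (hxy : InCommonSimplex x y)
      (hyz : HasBrokenPath y z l) : HasBrokenPath x z (ENNReal.ofReal (simplexDist x y) + l)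

theorem InCommonSimplex.symm {x y : Building n} (h : InCommonSimplex x y) :
    InCommonSimplex y x := by
  obtain ⟨σ, hσ, hx, hy⟩ := h
  exact ⟨σ, hσ, hy, hx⟩

theorem HasBrokenPath.trans {x y z : Building n} {l m : ENNReal} (h : HasBrokenPath x y l)
    (h' : HasBrokenPath y z m) : HasBrokenPath x z (l + m) := by
  induction h with
  | refl x => rwa [zero_add]
  | step hxy _ ih => rw [add_assoc]; exact HasBrokenPath.step hxy (ih h')

theorem HasBrokenPath.symm {x y : Building n} {l : ENNReal} (h : HasBrokenPath x y l) :
    HasBrokenPath y x l := by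
  induction h with
  | refl x => exact HasBrokenPath.refl x
  | @step x y z l hxy _ ih =>
    have h1 : HasBrokenPath y x (ENNReal.ofReal (simplexDist x y) + 0) := by
      have h2 : simplexDist x y = simplexDist y x := InnerProductGeometry.angle_comm _ _
      rw [h2]
      exact HasBrokenPath.step hxy.symm (HasBrokenPath.refl x)
    rw [add_zero] at h1
    rw [add_comm]
    exact ih.trans h1

/-- The length metric induced by the spherical metrics on the simplices: the infimum of the lengths
of the broken paths joining two points. -/
instance : EDist (Building n) := ⟨fun x y => sInf {l | HasBrokenPath x y l}⟩

instance : PseudoEMetricSpace (Building n) where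
  edist_self := fun x => le_antisymm (sInf_le (HasBrokenPath.refl x)) bot_le
  edist_comm := fun x y => by
    apply le_antisymm
    · exact le_sInf fun l hl => sInf_le (HasBrokenPath.symm hl)
    · exact le_sInf fun l hl => sInf_le (HasBrokenPath.symm hl)
  edist_triangle := fun x y z => by
    refine le_of_forall_gt fun c hc => ?_
    obtain ⟨a, ha, b, hb, hab⟩ : ∃ a, HasBrokenPath x y a ∧ ∃ b, HasBrokenPath y z b ∧ a + b < c := by
      change sInf {l | HasBrokenPath x y l} + sInf {l | HasBrokenPath y z l} < c at hc
      rw [ENNReal.sInf_add] at hc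
      simp only [iInf_lt_iff] at hc
      obtain ⟨a, ha, hc⟩ := hc
      rw [add_comm, ENNReal.sInf_add] at hc
      simp only [iInf_lt_iff] at hc
      obtain ⟨b, hb, hc⟩ := hc
      exact ⟨a, ha, b, hb, by rwa [add_comm]⟩
    exact lt_of_le_of_lt (sInf_le (ha.trans hb)) hab

/-- A geodesic of length `l`: an isometry on the interval `[0, l]`. -/
def IsGeodesic (γ : ℝ → Building n) (l : ℝ) : Prop :=
  Isometry ((Set.Icc 0 l).domRestrict γ)

end Building

end

/-!
The geodesic is half of a great circle in an apartment. If `L` is a line, `H` a hyperplane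
complementary to it, and `B < H`, then `L < L ⊔ B > B < H` is a path of three edges from `L` to the
antipodal vertex `H`. That it is isometric to `[0, π]` is seen by folding the building onto one
apartment: the folding is an isometry on every simplex, so it does not increase distances, and the
spherical distance from the image of `L` grows along the path at unit speed from `0` to `π`.

The path avoids the non-crossing partitions as soon as its vertices do, so it remains to choose `L`,
`H` and the fourth vertex. The line is spanned by a vector that is not of the form `eᵢ + eⱼ`, and
the hyperplane contains two crossing edges that it does not join. The choice depends on why `p` is
not a non-crossing partition: either its edges form a crossing partition, or they do not span `p`.
In the first case the given crossing is kept in `H` and in the fourth vertex; in the second a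
functional that vanishes on the edges of `p`, but not on `p`, shows that edges do not span the
fourth vertex.
-/

/-! ## Calibrated arcs -/

/-- A set `S` on which a calibrating function `F` restricts to a bijection onto `[s, t]` with
non-expansive inverse. If `F` is moreover 1-Lipschitz on the whole space, `S` is a geodesic segment
with arc length parameter `F`. -/
structure IsCalibratedArc {X : Type*} [PseudoEMetricSpace X] (F : X → ℝ) (S : Set X) (s t : ℝ) :
    Prop where
  bijOn : Set.BijOn F S (Set.Icc s t)
  edist_le : ∀ y ∈ S, ∀ z ∈ S, edist y z ≤ edist (F y) (F z)

namespace IsCalibratedArc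

variable {X : Type*} [PseudoEMetricSpace X] {F : X → ℝ} {S T : Set X} {s t u : ℝ}

theorem lt (hS : IsCalibratedArc F S s t) {p q : X} (hpS : p ∈ S) (hqS : q ∈ S) (hp : F p = s)
    (hq : F q = t) (hpq : p ≠ q) : s < t := by
  have hle : F p ≤ F q := by
    rw [hp]
    exact (hS.bijOn.mapsTo hqS).1
  rw [← hp, ← hq]
  exact hle.lt_of_ne (hS.bijOn.injOn.ne hpS hqS hpq)

theorem union (hS : IsCalibratedArc F S s t) (hT : IsCalibratedArc F T t u) {p : X} (hpS : p ∈ S)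
    (hpT : p ∈ T) (hp : F p = t) : IsCalibratedArc F (S ∪ T) s u := by
  have le_t : ∀ y ∈ S, F y ≤ t := fun y hy => (hS.bijOn.mapsTo hy).2
  have t_le : ∀ z ∈ T, t ≤ F z := fun z hz => (hT.bijOn.mapsTo hz).1
  have hst : s ≤ t := hp ▸ (hS.bijOn.mapsTo hpS).1
  have htu : t ≤ u := hp ▸ (hT.bijOn.mapsTo hpT).2
  have eq_of_eq : ∀ y ∈ S, ∀ z ∈ T, F y = F z → y = z := fun y hy z hz h => by
    have hy' : F y = F p := by linarith [le_t y hy, t_le z hz]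
    rw [hS.bijOn.injOn hy hpS hy', hT.bijOn.injOn hpT hz (hy' ▸ h)]
  have edist_le : ∀ y ∈ S, ∀ z ∈ T, edist y z ≤ edist (F y) (F z) := fun y hy z hz => by
    calc edist y z ≤ edist y p + edist p z := edist_triangle y p z
      _ ≤ edist (F y) (F p) + edist (F p) (F z) :=
          add_le_add (hS.edist_le y hy p hpS) (hT.edist_le p hpT z hz)
      _ = edist (F y) (F z) := by
          simp only [edist_dist, Real.dist_eq]
          rw [← ENNReal.ofReal_add (abs_nonneg _) (abs_nonneg _), abs_sub_comm (F y) (F p),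
            abs_sub_comm (F p) (F z), abs_sub_comm (F y) (F z),
            abs_of_nonneg (by linarith [le_t y hy]), abs_of_nonneg (by linarith [t_le z hz]),
            abs_of_nonneg (by linarith [le_t y hy, t_le z hz]), add_comm, sub_add_sub_cancel]
  refine ⟨?_, ?_⟩
  · rw [← Set.Icc_union_Icc_eq_Icc hst htu]
    refine hS.bijOn.union hT.bijOn ?_
    rintro y (hy | hy) z (hz | hz) h
    · exact hS.bijOn.injOn hy hz h
    · exact eq_of_eq y hy z hz h
    · exact (eq_of_eq z hz y hy h.symm).symm
    · exact hT.bijOn.injOn hy hz h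
  · rintro y (hy | hy) z (hz | hz)
    · exact hS.edist_le y hy z hz
    · exact edist_le y hy z hz
    · rw [edist_comm y z, edist_comm (F y)]
      exact edist_le z hz y hy
    · exact hT.edist_le y hy z hz

theorem exists_isometry [Nonempty X] (hS : IsCalibratedArc F S s t) (hF : LipschitzWith 1 F) :
    ∃ γ : ℝ → X, Isometry ((Set.Icc s t).domRestrict γ) ∧ Set.LeftInvOn γ F S := by
  let γ := Function.invFunOn F S
  have mem : ∀ a ∈ Set.Icc s t, γ a ∈ S := fun a ha => hS.bijOn.surjOn.mapsTo_invFunOn ha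
  have apply_eq : ∀ a ∈ Set.Icc s t, F (γ a) = a := hS.bijOn.surjOn.rightInvOn_invFunOn
  refine ⟨γ, fun ⟨a, ha⟩ ⟨b, hb⟩ => le_antisymm ?_ ?_, hS.bijOn.injOn.leftInvOn_invFunOn⟩
  · calc edist (γ a) (γ b) ≤ edist (F (γ a)) (F (γ b)) := hS.edist_le _ (mem a ha) _ (mem b hb)
      _ = edist a b := by rw [apply_eq a ha, apply_eq b hb]
  · calc edist a b = edist (F (γ a)) (F (γ b)) := by rw [apply_eq a ha, apply_eq b hb]
      _ ≤ edist (γ a) (γ b) := by simpa using hF (γ a) (γ b)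

end IsCalibratedArc

/-! ## Angles along a segment -/

section Angle

open InnerProductGeometry

variable {E : Type*} [NormedAddCommGroup E] [InnerProductSpace ℝ E]

theorem angle_eq_angle_add_angle_of_smul_eq {u v w : E} (hu : u ≠ 0) (hv : v ≠ 0) {a b c : ℝ}
    (ha : 0 ≤ a) (hb : 0 < b) (hc : 0 ≤ c) (h : a • v = b • u + c • w) :
    angle u w = angle u v + angle v w := by
  rcases ha.eq_or_lt with rfl | ha
  · have hu_eq : u = (-(c / b)) • w := by
      rw [zero_smul, eq_comm, add_eq_zero_iff_eq_neg] at h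
      rw [← inv_smul_smul₀ hb.ne' u, h, ← neg_smul, smul_smul]
      congr 1
      ring
    have hw : w ≠ 0 := fun hw => hu (by rw [hu_eq, hw, smul_zero])
    have hcb : -(c / b) < 0 := neg_lt_zero.mpr <| (div_nonneg hc hb.le).lt_of_ne fun hcb =>
      hu (by rw [hu_eq, ← hcb, neg_zero, zero_smul])
    have hπ : angle w u = Real.pi := angle_eq_pi_iff.mpr ⟨hw, _, hcb, hu_eq⟩
    rw [angle_comm u w, hπ, angle_comm u v, angle_comm v w, add_comm,
      ← angle_add_angle_eq_pi_of_angle_eq_pi v hπ, angle_comm v u]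
  · refine angle_eq_angle_add_add_angle_add_of_mem_span hv ?_
    rw [Submodule.mem_span_pair]
    refine ⟨(b / a).toNNReal, (c / a).toNNReal, ?_⟩
    rw [NNReal.smul_def, NNReal.smul_def, Real.coe_toNNReal _ (div_nonneg hb.le ha.le),
      Real.coe_toNNReal _ (div_nonneg hc ha.le), div_eq_inv_mul, div_eq_inv_mul, mul_smul,
      mul_smul, ← smul_add, ← h, inv_smul_smul₀ ha.ne']

variable {a b : E}

theorem lineMap_ne_zero (hab : LinearIndependent ℝ ![a, b]) (c : ℝ) :
    AffineMap.lineMap a b c ≠ 0 := fun h => by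
  rw [AffineMap.lineMap_apply_module] at h
  obtain ⟨h₁, rfl⟩ := LinearIndependent.pair_iff.mp hab _ _ h
  norm_num at h₁

theorem angle_lineMap_lineMap_pos (hab : LinearIndependent ℝ ![a, b]) {c c' : ℝ} (h : c ≠ c') :
    0 < angle (AffineMap.lineMap a b c) (AffineMap.lineMap a b c') := by
  refine (angle_nonneg _ _).lt_of_ne fun h₀ => h ?_
  obtain ⟨-, ρ, -, hρ⟩ := angle_eq_zero_iff.mp h₀.symm
  have hcomb : (1 - c' - ρ * (1 - c)) • a + (c' - ρ * c) • b = 0 := by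
    simp only [AffineMap.lineMap_apply_module] at hρ
    rw [← sub_eq_zero.mpr hρ]
    module
  obtain ⟨h₁, h₂⟩ := LinearIndependent.pair_iff.mp hab _ _ hcomb
  have hρ1 : ρ = 1 := by linarith
  subst hρ1
  linarith

variable {u : E} {r t : ℝ}

/-- The equation `hu` puts `u` on the great circle through `a` and `b`, on the arc from `-b` to `a`,
so that the angle with `u` only grows on the way from `a` to `b`. -/
theorem angle_lineMap_eq_add (hab : LinearIndependent ℝ ![a, b]) (hu₀ : u ≠ 0) (hr : 0 ≤ r)
    (ht : 0 ≤ t) (hu : u = r • a - t • b) {c c' : ℝ} (hc : 0 ≤ c) (hcc' : c < c') (hc' : c' ≤ 1) :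
    angle u (AffineMap.lineMap a b c') = angle u (AffineMap.lineMap a b c)
      + angle (AffineMap.lineMap a b c) (AffineMap.lineMap a b c') := by
  refine angle_eq_angle_add_angle_of_smul_eq hu₀ (lineMap_ne_zero hab c)
    (a := r * c' + t * (1 - c')) (b := c' - c) (c := r * c + t * (1 - c)) ?_ (sub_pos.mpr hcc')
    ?_ ?_
  · have := sub_nonneg.mpr hc'
    have := hc.trans hcc'.le
    positivity
  · have : 0 ≤ 1 - c := by linarith
    positivity
  · simp only [AffineMap.lineMap_apply_module, hu]
    module

theorem bijOn_angle_lineMap (hab : LinearIndependent ℝ ![a, b]) (hu₀ : u ≠ 0) (hr : 0 ≤ r)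
    (ht : 0 ≤ t) (hu : u = r • a - t • b) :
    Set.BijOn (fun c : ℝ => angle u (AffineMap.lineMap a b c)) (Set.Icc 0 1)
      (Set.Icc (angle u a) (angle u b)) := by
  let f (c : ℝ) : ℝ := angle u (AffineMap.lineMap a b c)
  have mono : StrictMonoOn f (Set.Icc 0 1) := fun c hc c' hc' hcc' => by
    simp only [f, angle_lineMap_eq_add hab hu₀ hr ht hu hc.1 hcc' hc'.2]
    exact lt_add_of_pos_right _ (angle_lineMap_lineMap_pos hab hcc'.ne)
  have cont : Continuous f := continuous_iff_continuousAt.mpr fun c =>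
    (continuousAt_angle hu₀ (lineMap_ne_zero hab c)).comp₂ continuousAt_const
      AffineMap.lineMap_continuous.continuousAt
  have f_zero : f 0 = angle u a := by simp only [f, AffineMap.lineMap_apply_zero]
  have f_one : f 1 = angle u b := by simp only [f, AffineMap.lineMap_apply_one]
  rw [← f_zero, ← f_one]
  exact ⟨mono.monotoneOn.mapsTo_Icc, mono.injOn,
    intermediate_value_Icc zero_le_one cont.continuousOn⟩

end Angle

/-! ## Apartments -/

section ApartmentVector

variable {ι : Type*} [Fintype ι] [DecidableEq ι]

/-- The vector on the ray of the vertex `S` of the Coxeter complex of the symmetric group of `ι`,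
whose simplices are the chains of proper non-empty subsets of `ι`: the orthogonal projection of the
indicator vector of `S` to the space of vectors with coordinate sum zero. -/
noncomputable def apartmentVector (S : Finset ι) : EuclideanSpace ℝ ι :=
  WithLp.toLp 2 fun k => (if k ∈ S then 1 else 0) - (S.card : ℝ) / Fintype.card ι

theorem apartmentVector_apply (S : Finset ι) (k : ι) :
    apartmentVector S k = (if k ∈ S then 1 else 0) - (S.card : ℝ) / Fintype.card ι :=
  rfl

theorem inner_apartmentVector (S T : Finset ι) :
    inner ℝ (apartmentVector S) (apartmentVector T)
      = ((S ∩ T).card : ℝ) - S.card * T.card / Fintype.card ι := by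
  rcases isEmpty_or_nonempty ι with hι | hι
  · simp [Subsingleton.elim (apartmentVector _) (0 : EuclideanSpace ℝ ι),
      Finset.eq_empty_of_isEmpty]
  have hcard : (Fintype.card ι : ℝ) ≠ 0 := by exact_mod_cast Fintype.card_ne_zero
  have hterm : ∀ k, inner ℝ (apartmentVector S k) (apartmentVector T k)
      = (if k ∈ S ∩ T then 1 else 0) - (if k ∈ S then 1 else 0) * (T.card / Fintype.card ι : ℝ)
        - (if k ∈ T then 1 else 0) * (S.card / Fintype.card ι : ℝ)
        + S.card / Fintype.card ι * (T.card / Fintype.card ι) := fun k => by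
    simp only [apartmentVector_apply, RCLike.inner_apply, conj_trivial, Finset.mem_inter, ite_and]
    split_ifs <;> ring
  simp only [PiLp.inner_apply, hterm, Finset.sum_add_distrib, Finset.sum_sub_distrib,
    ← Finset.sum_mul, Finset.sum_boole, Finset.filter_univ_mem, Finset.sum_const, Finset.card_univ,
    nsmul_eq_mul]
  field_simp
  ring

theorem apartmentVector_union {S T : Finset ι} (h : Disjoint S T) :
    apartmentVector (S ∪ T) = apartmentVector S + apartmentVector T := by
  ext k
  have hk : k ∈ S → k ∉ T := fun hS hT => Finset.disjoint_left.mp h hS hT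
  simp only [PiLp.add_apply, apartmentVector_apply, Finset.card_union_of_disjoint h,
    Finset.mem_union]
  push_cast
  by_cases hS : k ∈ S <;> by_cases hT : k ∈ T <;> simp_all <;> ring

theorem apartmentVector_add_compl (S : Finset ι) :
    apartmentVector S + apartmentVector Sᶜ = 0 := by
  rw [← apartmentVector_union disjoint_compl_right, Finset.union_compl]
  ext k
  have : Nonempty ι := ⟨k⟩
  simp [apartmentVector_apply]

theorem linearIndependent_apartmentVector {S T : Finset ι} (hS : S.Nonempty) (hST : S ⊂ T)
    (hT : T ≠ Finset.univ) :
    LinearIndependent ℝ ![apartmentVector S, apartmentVector T] := by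
  obtain ⟨i, hi⟩ := hS
  obtain ⟨j, hjT, hjS⟩ := Finset.exists_of_ssubset hST
  obtain ⟨k, hk⟩ : ∃ k, k ∉ T := by simpa [Finset.eq_univ_iff_forall] using hT
  have hkS : k ∉ S := fun h => hk (hST.subset h)
  refine LinearIndependent.pair_iff.mpr fun s t h => ?_
  have hcoord : ∀ l, s * apartmentVector S l + t * apartmentVector T l = 0 := fun l => by
    simpa using congrArg (· l) h
  have hi' := hcoord i
  have hj' := hcoord j
  have hk' := hcoord k
  simp only [apartmentVector_apply, hi, hST.subset hi, hjS, hjT, hk, hkS,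
    if_true, if_false] at hi' hj' hk'
  constructor <;> linarith

end ApartmentVector

namespace BuildingVertex

variable {n : ℕ} {U U' : BuildingVertex n}

theorem rank_lt (U : BuildingVertex n) : U.rank < n - 1 := by
  have := Submodule.finrank_lt U.2.2
  rwa [Module.finrank_fin_fun] at this

theorem rank_pos (U : BuildingVertex n) : 0 < U.rank :=
  Module.finrank_pos_iff.mpr ((Submodule.nontrivial_iff_ne_bot).mpr U.2.1)

theorem rank_le_rank (h : U ≤ U') : U.rank ≤ U'.rank :=
  Submodule.finrank_mono h

theorem rank_lt_rank (h : U < U') : U.rank < U'.rank :=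
  Submodule.finrank_lt_finrank_of_lt h

theorem Adjacent.ne (h : U.Adjacent U') : U ≠ U' :=
  h.elim LT.lt.ne LT.lt.ne'

theorem Adjacent.symm (h : U.Adjacent U') : U'.Adjacent U :=
  Or.symm h

theorem Adjacent.pair_mem_faces [DecidableEq (BuildingVertex n)] (h : U.Adjacent U') :
    {U, U'} ∈ (buildingComplex n).faces := by
  refine ⟨Finset.insert_nonempty _ _, ?_⟩
  rw [Finset.coe_pair]
  rcases h with h | h
  · exact IsChain.pair h.le
  · rw [Set.pair_comm]
    exact IsChain.pair h.le

end BuildingVertex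

/-- A type-preserving folding of the building onto an apartment, given by the subset of
`Fin (n - 1)` that names the image of a vertex. -/
structure IsFold {n : ℕ} (φ : BuildingVertex n → Finset (Fin (n - 1))) : Prop where
  card_eq : ∀ U, (φ U).card = U.rank
  mono : Monotone φ

namespace IsFold

variable {n : ℕ} {φ : BuildingVertex n → Finset (Fin (n - 1))} {U U' : BuildingVertex n}

theorem nonempty (hφ : IsFold φ) (U : BuildingVertex n) : (φ U).Nonempty :=
  Finset.card_pos.mp (hφ.card_eq U ▸ U.rank_pos)

theorem ne_univ (hφ : IsFold φ) (U : BuildingVertex n) : φ U ≠ Finset.univ := fun h => by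
  have := U.rank_lt
  rw [← hφ.card_eq, h, Finset.card_fin] at this
  exact this.false

theorem ssubset (hφ : IsFold φ) (h : U < U') : φ U ⊂ φ U' :=
  (hφ.mono h.le).ssubset_of_ne fun heq => by
    have := BuildingVertex.rank_lt_rank h
    rw [← hφ.card_eq, ← hφ.card_eq, heq] at this
    exact this.false

theorem linearIndependent (hφ : IsFold φ) (h : U.Adjacent U') :
    LinearIndependent ℝ ![apartmentVector (φ U), apartmentVector (φ U')] := by
  rcases h with h | h
  · exact linearIndependent_apartmentVector (hφ.nonempty U) (hφ.ssubset h) (hφ.ne_univ U')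
  · exact LinearIndependent.pair_symm_iff.mp
      (linearIndependent_apartmentVector (hφ.nonempty U') (hφ.ssubset h) (hφ.ne_univ U))

end IsFold

namespace Building

variable {n : ℕ}

theorem chamberVector_eq_apartmentVector {i : ℕ} (hi : i ≤ n - 1) :
    chamberVector n i = apartmentVector {k : Fin (n - 1) | (k : ℕ) < i} := by
  ext k
  simp [chamberVector, apartmentVector_apply, Fin.card_filter_val_lt, hi]

theorem inner_chamberVector {i j : ℕ} (hij : i ≤ j) (hj : j ≤ n - 1) :
    inner ℝ (chamberVector n i) (chamberVector n j) = (i : ℝ) - i * j / ((n - 1 : ℕ) : ℝ) := by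
  have hsub : Finset.univ.filter (fun k : Fin (n - 1) => (k : ℕ) < i)
      ⊆ Finset.univ.filter fun k => (k : ℕ) < j :=
    Finset.monotone_filter_right _ fun _ _ (h : _ < i) => h.trans_le hij
  rw [chamberVector_eq_apartmentVector (hij.trans hj), chamberVector_eq_apartmentVector hj,
    inner_apartmentVector, Finset.inter_eq_left.mpr hsub, Fin.card_filter_val_lt,
    Fin.card_filter_val_lt, min_eq_right hj, min_eq_right (hij.trans hj), Fintype.card_fin]

theorem edist_le_simplexDist {y z : Building n} (h : InCommonSimplex y z) :
    edist y z ≤ ENNReal.ofReal (simplexDist y z) := by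
  refine sInf_le ?_
  have := HasBrokenPath.step h (HasBrokenPath.refl z)
  rwa [add_zero] at this

theorem lipschitzWith_one_of_edist_le_simplexDist {α : Type*} [PseudoEMetricSpace α]
    {F : Building n → α}
    (hF : ∀ y z, InCommonSimplex y z → edist (F y) (F z) ≤ ENNReal.ofReal (simplexDist y z)) :
    LipschitzWith 1 F := fun y z => by
  rw [ENNReal.coe_one, one_mul]
  refine le_sInf fun l hl => ?_
  induction hl with
  | refl y => simp
  | @step y w z l hyw _ ih =>
    exact (edist_triangle _ (F w) _).trans (add_le_add (hF y w hyw) ih)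

/-- The image of a point of the building in the apartment that a folding maps to, as the point of
the unit sphere on the ray through a vector. -/
noncomputable def foldChart (φ : BuildingVertex n → Finset (Fin (n - 1))) (y : Building n) :
    EuclideanSpace ℝ (Fin (n - 1)) :=
  y.weight.sum fun U c => c • apartmentVector (φ U)

theorem foldChart_ofVertex (φ : BuildingVertex n → Finset (Fin (n - 1))) (U : BuildingVertex n) :
    foldChart φ (ofVertex U) = apartmentVector (φ U) := by
  simp [foldChart, ofVertex]

end Building

namespace IsFold

open Building InnerProductGeometry

variable {n : ℕ} {φ : BuildingVertex n → Finset (Fin (n - 1))} {U U' : BuildingVertex n}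

theorem inner_apartmentVector_of_le (hφ : IsFold φ) (h : U ≤ U') :
    inner ℝ (apartmentVector (φ U)) (apartmentVector (φ U'))
      = inner ℝ (chamberVector n U.rank) (chamberVector n U'.rank) := by
  rw [inner_apartmentVector, Finset.inter_eq_left.mpr (hφ.mono h), hφ.card_eq, hφ.card_eq,
    inner_chamberVector (BuildingVertex.rank_le_rank h) U'.rank_lt.le, Fintype.card_fin]

theorem inner_foldChart (hφ : IsFold φ) {y z : Building n} (h : InCommonSimplex y z) :
    inner ℝ (foldChart φ y) (foldChart φ z) = inner ℝ (chart y) (chart z) := by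
  obtain ⟨σ, hσ, hy, hz⟩ := h
  simp only [foldChart, chart, Finsupp.sum, sum_inner, inner_sum, real_inner_smul_left,
    real_inner_smul_right]
  refine Finset.sum_congr rfl fun U' hU' => Finset.sum_congr rfl fun U hU => ?_
  congr 2
  rcases hσ.2.total (hy hU) (hz hU') with hle | hle
  · exact hφ.inner_apartmentVector_of_le hle
  · rw [real_inner_comm, hφ.inner_apartmentVector_of_le hle, real_inner_comm]

theorem angle_foldChart (hφ : IsFold φ) {y z : Building n} (h : InCommonSimplex y z) :
    angle (foldChart φ y) (foldChart φ z) = simplexDist y z := by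
  obtain ⟨σ, hσ, hy, hz⟩ := h
  simp only [simplexDist, angle, norm_eq_sqrt_real_inner, hφ.inner_foldChart ⟨σ, hσ, hy, hz⟩,
    hφ.inner_foldChart ⟨σ, hσ, hy, hy⟩, hφ.inner_foldChart ⟨σ, hσ, hz, hz⟩]

theorem lipschitzWith_angle_foldChart (hφ : IsFold φ) (u : EuclideanSpace ℝ (Fin (n - 1))) :
    LipschitzWith 1 fun y : Building n => angle u (foldChart φ y) :=
  lipschitzWith_one_of_edist_le_simplexDist fun y z h => by
    rw [edist_dist, Real.dist_eq, ← hφ.angle_foldChart h]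
    refine ENNReal.ofReal_le_ofReal (abs_sub_le_iff.mpr ⟨?_, ?_⟩)
    · rw [sub_le_iff_le_add', angle_comm (foldChart φ y)]
      exact angle_le_angle_add_angle u (foldChart φ z) (foldChart φ y)
    · rw [sub_le_iff_le_add']
      exact angle_le_angle_add_angle u (foldChart φ y) (foldChart φ z)

end IsFold

/-! ## Geodesics made of three edges -/

namespace Building

variable {n : ℕ} {U U' : BuildingVertex n}

theorem ext_weight {y z : Building n} (h : y.weight = z.weight) : y = z := by
  cases y
  cases z
  cases h
  rfl

theorem ofVertex_injective : Function.Injective (ofVertex (n := n)) := fun U U' h => by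
  have hw : (Finsupp.single U 1 : BuildingVertex n →₀ ℝ) = Finsupp.single U' 1 :=
    congrArg weight h
  exact Finsupp.single_left_injective one_ne_zero hw

theorem ofVertex_mem_edge_left (U U' : BuildingVertex n) : ofVertex U ∈ edge U U' :=
  fun _ hV => .inl (by simpa using Finsupp.support_single_subset hV)

theorem ofVertex_mem_edge_right (U U' : BuildingVertex n) : ofVertex U' ∈ edge U U' :=
  fun _ hV => .inr (by simpa using Finsupp.support_single_subset hV)

theorem inCommonSimplex_of_mem_edge (h : U.Adjacent U') {y z : Building n} (hy : y ∈ edge U U')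
    (hz : z ∈ edge U U') : InCommonSimplex y z := by
  classical
  exact ⟨{U, U'}, h.pair_mem_faces, fun V hV => by simpa using hy V hV,
    fun V hV => by simpa using hz V hV⟩

theorem sum_weight_of_mem_edge {M : Type*} [AddCommMonoid M] (hne : U ≠ U') {y : Building n}
    (hy : y ∈ edge U U') (f : BuildingVertex n → ℝ → M) (hf : ∀ V, f V 0 = 0) :
    y.weight.sum f = f U (y.weight U) + f U' (y.weight U') := by
  classical
  rw [Finsupp.sum_of_support_subset (s := {U, U'}) y.weight
    (fun V hV => by simpa using hy V hV) f fun V _ => hf V, Finset.sum_pair hne]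

theorem weight_add_weight_of_mem_edge (hne : U ≠ U') {y : Building n} (hy : y ∈ edge U U') :
    y.weight U + y.weight U' = 1 := by
  rw [← y.sum_weight, sum_weight_of_mem_edge hne hy _ fun _ => rfl]

theorem exists_mem_edge_weight_eq (h : U.Adjacent U') {c : ℝ} (hc : c ∈ Set.Icc (0 : ℝ) 1) :
    ∃ y ∈ edge U U', y.weight U' = c := by
  classical
  let w : BuildingVertex n →₀ ℝ := Finsupp.single U (1 - c) + Finsupp.single U' c
  have support_subset : w.support ⊆ {U, U'} := Finsupp.support_add.trans <|
    Finset.union_subset_union Finsupp.support_single_subset Finsupp.support_single_subset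
  have nonneg : 0 ≤ w := add_nonneg (Finsupp.single_nonneg.mpr (sub_nonneg.mpr hc.2))
    (Finsupp.single_nonneg.mpr hc.1)
  have sum_eq : (w.sum fun _ c => c) = 1 := by
    rw [Finsupp.sum_add_index' (fun _ => rfl) (fun _ _ _ => rfl), Finsupp.sum_single_index rfl,
      Finsupp.sum_single_index rfl, sub_add_cancel]
  have support_nonempty : w.support.Nonempty := by
    rw [Finset.nonempty_iff_ne_empty, Ne, Finsupp.support_eq_empty]
    intro h₀
    rw [h₀, Finsupp.sum_zero_index] at sum_eq
    exact zero_ne_one sum_eq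
  refine ⟨⟨w, nonneg, ((buildingComplex n).isRelLowerSet_faces h.pair_mem_faces).2 support_subset
    support_nonempty, sum_eq⟩, fun V hV => by simpa using support_subset hV, ?_⟩
  simp [w, Finsupp.single_eq_of_ne h.ne.symm]

theorem bijOn_weight_edge (h : U.Adjacent U') :
    Set.BijOn (fun y : Building n => y.weight U') (edge U U') (Set.Icc 0 1) := by
  refine ⟨fun y hy => ⟨y.weight_nonneg U', ?_⟩, fun y hy z hz hyz => ?_,
    fun c hc => exists_mem_edge_weight_eq h hc⟩
  · linarith [y.weight_nonneg U, weight_add_weight_of_mem_edge h.ne hy]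
  · refine ext_weight (Finsupp.ext fun V => ?_)
    by_cases hV : V = U ∨ V = U'
    · rcases hV with rfl | rfl
      · linarith [weight_add_weight_of_mem_edge h.ne hy, weight_add_weight_of_mem_edge h.ne hz,
          show y.weight U' = z.weight U' from hyz]
      · exact hyz
    · rw [Finsupp.notMem_support_iff.mp fun h' => hV (hy V h'),
        Finsupp.notMem_support_iff.mp fun h' => hV (hz V h')]

theorem foldChart_of_mem_edge (φ : BuildingVertex n → Finset (Fin (n - 1))) (hne : U ≠ U')
    {y : Building n} (hy : y ∈ edge U U') :
    foldChart φ y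
      = AffineMap.lineMap (apartmentVector (φ U)) (apartmentVector (φ U')) (y.weight U') := by
  rw [foldChart,
    sum_weight_of_mem_edge hne hy (fun V c => c • apartmentVector (φ V)) fun _ => zero_smul _ _,
    AffineMap.lineMap_apply_module, ← weight_add_weight_of_mem_edge hne hy, add_sub_cancel_right]

theorem disjoint_edge_ncp (hU : ¬ U.IsNCP) (hU' : ¬ U'.IsNCP) : Disjoint (edge U U') (ncp n) := by
  rw [Set.disjoint_left]
  rintro y hy ⟨⟨⟨V, hV⟩, -⟩, hncp⟩
  rcases hy V hV with rfl | rfl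
  · exact hU (hncp _ hV)
  · exact hU' (hncp _ hV)

/-- `γ` is a geodesic of length `π` that runs through the edges `p₀p₁`, `p₁p₂` and `p₂p₃`, with
`p₁` at time `a` and `p₂` at time `b`. -/
structure IsThreeEdgeGeodesic (γ : ℝ → Building n) (p₀ p₁ p₂ p₃ : BuildingVertex n) (a b : ℝ) :
    Prop where
  isGeodesic : IsGeodesic γ Real.pi
  pos : 0 < a
  lt : a < b
  lt_pi : b < Real.pi
  map_zero : γ 0 = ofVertex p₀
  map_left : γ a = ofVertex p₁
  map_right : γ b = ofVertex p₂
  map_pi : γ Real.pi = ofVertex p₃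
  image_first : γ '' Set.Icc 0 a = edge p₀ p₁
  image_second : γ '' Set.Icc a b = edge p₁ p₂
  image_third : γ '' Set.Icc b Real.pi = edge p₂ p₃

theorem IsThreeEdgeGeodesic.ofVertex_mem_image {γ : ℝ → Building n}
    {p₀ p₁ p₂ p₃ : BuildingVertex n} {a b : ℝ} (h : IsThreeEdgeGeodesic γ p₀ p₁ p₂ p₃ a b) :
    ofVertex p₁ ∈ γ '' Set.Icc 0 Real.pi :=
  ⟨a, ⟨h.pos.le, (h.lt.trans h.lt_pi).le⟩, h.map_left⟩

theorem IsThreeEdgeGeodesic.disjoint_ncp {γ : ℝ → Building n} {p₀ p₁ p₂ p₃ : BuildingVertex n}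
    {a b : ℝ} (h : IsThreeEdgeGeodesic γ p₀ p₁ p₂ p₃ a b) (h₀ : ¬ p₀.IsNCP) (h₁ : ¬ p₁.IsNCP)
    (h₂ : ¬ p₂.IsNCP) (h₃ : ¬ p₃.IsNCP) : Disjoint (γ '' Set.Icc 0 Real.pi) (ncp n) := by
  rw [← Set.Icc_union_Icc_eq_Icc (h.pos.trans h.lt).le h.lt_pi.le,
    ← Set.Icc_union_Icc_eq_Icc h.pos.le h.lt.le, Set.image_union, Set.image_union, h.image_first,
    h.image_second, h.image_third, Set.disjoint_union_left, Set.disjoint_union_left]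
  exact ⟨⟨disjoint_edge_ncp h₀ h₁, disjoint_edge_ncp h₁ h₂⟩, disjoint_edge_ncp h₂ h₃⟩

theorem exists_isThreeEdgeGeodesic_of_isCalibratedArc {F : Building n → ℝ}
    (hF : LipschitzWith 1 F) {p₀ p₁ p₂ p₃ : BuildingVertex n} (h₁ : p₀ ≠ p₁) (h₂ : p₁ ≠ p₂)
    (h₃ : p₂ ≠ p₃) (F_zero : F (ofVertex p₀) = 0) (F_pi : F (ofVertex p₃) = Real.pi)
    (arc₁ : IsCalibratedArc F (edge p₀ p₁) (F (ofVertex p₀)) (F (ofVertex p₁)))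
    (arc₂ : IsCalibratedArc F (edge p₁ p₂) (F (ofVertex p₁)) (F (ofVertex p₂)))
    (arc₃ : IsCalibratedArc F (edge p₂ p₃) (F (ofVertex p₂)) (F (ofVertex p₃))) :
    ∃ γ a b, IsThreeEdgeGeodesic γ p₀ p₁ p₂ p₃ a b := by
  rw [F_zero] at arc₁
  rw [F_pi] at arc₃
  have mem_left := ofVertex_mem_edge_left (n := n)
  have mem_right := ofVertex_mem_edge_right (n := n)
  have arc := (arc₁.union arc₂ (mem_right _ _) (mem_left _ _) rfl).union arc₃
    (.inr (mem_right _ _)) (mem_left _ _) rfl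
  have : Nonempty (Building n) := ⟨ofVertex p₀⟩
  obtain ⟨γ, hγ, hγF⟩ := arc.exists_isometry hF
  have image_eq : ∀ {S s t}, S ⊆ edge p₀ p₁ ∪ edge p₁ p₂ ∪ edge p₂ p₃ → IsCalibratedArc F S s t →
      γ '' Set.Icc s t = S := fun hS h => by
    rw [← h.bijOn.image_eq, hγF.image_image' hS]
  exact ⟨γ, F (ofVertex p₁), F (ofVertex p₂), {
    isGeodesic := hγ
    pos := arc₁.lt (mem_left _ _) (mem_right _ _) F_zero rfl (ofVertex_injective.ne h₁)
    lt := arc₂.lt (mem_left _ _) (mem_right _ _) rfl rfl (ofVertex_injective.ne h₂)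
    lt_pi := arc₃.lt (mem_left _ _) (mem_right _ _) rfl F_pi (ofVertex_injective.ne h₃)
    map_zero := F_zero ▸ hγF (.inl (.inl (mem_left _ _)))
    map_left := hγF (.inl (.inl (mem_right _ _)))
    map_right := hγF (.inr (mem_left _ _))
    map_pi := F_pi ▸ hγF (.inr (mem_right _ _))
    image_first := image_eq (Set.subset_union_left.trans Set.subset_union_left) arc₁
    image_second := image_eq (Set.subset_union_right.trans Set.subset_union_left) arc₂
    image_third := image_eq Set.subset_union_right arc₃ }⟩

end Building

namespace IsFold

open Building InnerProductGeometry

variable {n : ℕ} {φ : BuildingVertex n → Finset (Fin (n - 1))} {U U' : BuildingVertex n}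

theorem isCalibratedArc_edge (hφ : IsFold φ) (h : U.Adjacent U')
    {u : EuclideanSpace ℝ (Fin (n - 1))} (hu₀ : u ≠ 0) {r t : ℝ} (hr : 0 ≤ r) (ht : 0 ≤ t)
    (hu : u = r • apartmentVector (φ U) - t • apartmentVector (φ U')) :
    IsCalibratedArc (fun y => angle u (foldChart φ y)) (edge U U')
      (angle u (apartmentVector (φ U))) (angle u (apartmentVector (φ U'))) := by
  have hab := hφ.linearIndependent h
  refine ⟨((bijOn_angle_lineMap hab hu₀ hr ht hu).comp (bijOn_weight_edge h)).congr fun y hy => ?_,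
    fun y hy z hz => ?_⟩
  · simp only [Function.comp_apply, foldChart_of_mem_edge φ h.ne hy]
  have edist_le_of_lt : ∀ y ∈ edge U U', ∀ z ∈ edge U U', y.weight U' < z.weight U' →
      edist y z ≤ edist (angle u (foldChart φ y)) (angle u (foldChart φ z)) := by
    intro y hy z hz hlt
    have hadd := angle_lineMap_eq_add hab hu₀ hr ht hu (y.weight_nonneg U') hlt
      ((bijOn_weight_edge h).mapsTo hz).2
    rw [← foldChart_of_mem_edge φ h.ne hy, ← foldChart_of_mem_edge φ h.ne hz] at hadd
    have hyz := inCommonSimplex_of_mem_edge h hy hz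
    refine (edist_le_simplexDist hyz).trans_eq ?_
    rw [← hφ.angle_foldChart hyz, edist_dist, Real.dist_eq, hadd, sub_add_cancel_left, abs_neg,
      abs_of_nonneg (angle_nonneg _ _)]
  rcases lt_trichotomy (y.weight U') (z.weight U') with hlt | heq | hlt
  · exact edist_le_of_lt y hy z hz hlt
  · rw [(bijOn_weight_edge h).injOn hy hz heq, edist_self]
    exact zero_le
  · rw [edist_comm y z, edist_comm (angle u (foldChart φ y))]
    exact edist_le_of_lt z hz y hy hlt

theorem exists_isThreeEdgeGeodesic (hφ : IsFold φ) {p₀ p₁ p₂ p₃ : BuildingVertex n}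
    (h₁ : p₀.Adjacent p₁) (h₂ : p₁.Adjacent p₂) (h₃ : p₂.Adjacent p₃)
    (hadd : apartmentVector (φ p₀) + apartmentVector (φ p₂) = apartmentVector (φ p₁))
    (hneg : apartmentVector (φ p₀) + apartmentVector (φ p₃) = 0) :
    ∃ γ a b, IsThreeEdgeGeodesic γ p₀ p₁ p₂ p₃ a b := by
  let u := apartmentVector (φ p₀)
  have hu₀ : u ≠ 0 := (hφ.linearIndependent h₁).ne_zero 0
  have angle_pi : angle u (apartmentVector (φ p₃)) = Real.pi := by
    rw [← neg_eq_of_add_eq_zero_right hneg, angle_self_neg_of_nonzero hu₀]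
  refine exists_isThreeEdgeGeodesic_of_isCalibratedArc (hφ.lipschitzWith_angle_foldChart u)
    h₁.ne h₂.ne h₃.ne ?_ ?_ ?_ ?_ ?_ <;> simp only [foldChart_ofVertex]
  · exact angle_self hu₀
  · exact angle_pi
  · exact hφ.isCalibratedArc_edge h₁ hu₀ zero_le_one le_rfl (by rw [one_smul, zero_smul, sub_zero])
  · exact hφ.isCalibratedArc_edge h₂ hu₀ zero_le_one zero_le_one
      (by rw [one_smul, one_smul, ← hadd, add_sub_cancel_right])
  · exact hφ.isCalibratedArc_edge h₃ hu₀ le_rfl zero_le_one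
      (by rw [one_smul, zero_smul, zero_sub, ← eq_neg_of_add_eq_zero_left hneg])

end IsFold

/-! ## Meridians -/

namespace BuildingVertex

variable {n : ℕ}

open Classical in
/-- The folding of the building centred at a line `L`: a vertex of rank `r` is mapped to the first
`r` elements of `Fin (n - 1)` if it contains `L`, and to the `r` elements after the first one
otherwise. -/
noncomputable def foldAt (L U : BuildingVertex n) : Finset (Fin (n - 1)) :=
  let s := if L ≤ U then 0 else 1
  (Finset.Ico s (s + U.rank)).attachFin fun k hk => by
    have := U.rank_lt
    have hk' := (Finset.mem_Ico.mp hk).2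
    have : s ≤ 1 := by simp only [s]; split_ifs <;> omega
    omega

variable {L U : BuildingVertex n} {k : Fin (n - 1)}

theorem mem_foldAt_of_le (h : L ≤ U) : k ∈ L.foldAt U ↔ (k : ℕ) < U.rank := by
  simp [foldAt, h]

theorem mem_foldAt_of_not_le (h : ¬ L ≤ U) :
    k ∈ L.foldAt U ↔ 1 ≤ (k : ℕ) ∧ (k : ℕ) < 1 + U.rank := by
  simp [foldAt, h]

theorem isFold_foldAt (L : BuildingVertex n) : IsFold L.foldAt where
  card_eq U := by simp [foldAt]
  mono U U' hUU' := by
    rcases hUU'.eq_or_lt with rfl | hlt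
    · exact le_rfl
    have hrank := rank_lt_rank hlt
    intro k hk
    by_cases hU : L ≤ U
    · rw [mem_foldAt_of_le hU] at hk
      rw [mem_foldAt_of_le (hU.trans hUU')]
      omega
    · rw [mem_foldAt_of_not_le hU] at hk
      by_cases hU' : L ≤ U'
      · rw [mem_foldAt_of_le hU']
        omega
      · rw [mem_foldAt_of_not_le hU']
        omega

end BuildingVertex

/-- The configuration of a line `L`, a hyperplane `H` complementary to it, a subspace `B` of `H`,
and `A = L ⊔ B`. These are the successive vertices of half a great circle in an apartment. -/
structure IsMeridian {n : ℕ} (L A B H : BuildingVertex n) : Prop where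
  rank_eq_one : L.rank = 1
  isCompl : IsCompl L.1 H.1
  le : B ≤ H
  sup_eq : L.1 ⊔ B.1 = A.1

namespace IsMeridian

variable {n : ℕ} {L A B H : BuildingVertex n}

theorem not_line_le (h : IsMeridian L A B H) : ¬ L ≤ H := fun hle =>
  L.2.1 (le_bot_iff.mp (h.isCompl.disjoint le_rfl hle))

theorem rank_hyperplane (h : IsMeridian L A B H) : H.rank + 1 = n - 1 := by
  have : L.rank + H.rank = _ := Submodule.finrank_add_eq_of_isCompl h.isCompl
  rwa [Module.finrank_fin_fun, h.rank_eq_one, add_comm] at this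

theorem rank_sup (h : IsMeridian L A B H) : A.rank = B.rank + 1 := by
  have hinf : L.1 ⊓ B.1 = ⊥ := (Disjoint.mono_right (show B.1 ≤ H.1 from h.le)
    h.isCompl.disjoint).eq_bot
  have := Submodule.finrank_sup_add_finrank_inf_eq L.1 B.1
  rw [h.sup_eq, hinf, finrank_bot, add_zero, add_comm] at this
  exact this.trans (congrArg (B.rank + ·) h.rank_eq_one)

theorem line_le_sup (h : IsMeridian L A B H) : L ≤ A :=
  show L.1 ≤ A.1 from h.sup_eq ▸ le_sup_left

theorem le_sup (h : IsMeridian L A B H) : B ≤ A :=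
  show B.1 ≤ A.1 from h.sup_eq ▸ le_sup_right

theorem adjacent_line_sup (h : IsMeridian L A B H) : L.Adjacent A :=
  .inl <| h.line_le_sup.lt_of_ne fun heq => by
    have hrank := h.rank_sup
    have := B.rank_pos
    rw [← heq, h.rank_eq_one] at hrank
    omega

theorem adjacent_sup (h : IsMeridian L A B H) : A.Adjacent B :=
  .inr <| h.le_sup.lt_of_ne fun heq => h.not_line_le ((heq ▸ h.line_le_sup).trans h.le)

theorem adjacent_hyperplane (h : IsMeridian L A B H) : B.Adjacent H :=
  .inl <| h.le.lt_of_ne fun heq => by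
    have := h.rank_sup
    have := h.rank_hyperplane
    have := A.rank_lt
    subst heq
    omega

theorem foldAt_sup (h : IsMeridian L A B H) : L.foldAt A = L.foldAt L ∪ L.foldAt B := by
  ext k
  rw [Finset.mem_union, BuildingVertex.mem_foldAt_of_le h.line_le_sup,
    BuildingVertex.mem_foldAt_of_le le_rfl,
    BuildingVertex.mem_foldAt_of_not_le fun hle => h.not_line_le (hle.trans h.le), h.rank_sup,
    h.rank_eq_one]
  omega

theorem disjoint_foldAt (h : IsMeridian L A B H) : Disjoint (L.foldAt L) (L.foldAt B) := by
  rw [Finset.disjoint_left]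
  intro k hk
  rw [BuildingVertex.mem_foldAt_of_le le_rfl, h.rank_eq_one] at hk
  rw [BuildingVertex.mem_foldAt_of_not_le fun hle => h.not_line_le (hle.trans h.le)]
  omega

theorem foldAt_hyperplane (h : IsMeridian L A B H) : L.foldAt H = (L.foldAt L)ᶜ := by
  ext k
  have := h.rank_hyperplane
  rw [Finset.mem_compl, BuildingVertex.mem_foldAt_of_not_le h.not_line_le,
    BuildingVertex.mem_foldAt_of_le le_rfl, h.rank_eq_one]
  omega

theorem apartmentVector_sup (h : IsMeridian L A B H) :
    apartmentVector (L.foldAt A) = apartmentVector (L.foldAt L) + apartmentVector (L.foldAt B) := by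
  rw [h.foldAt_sup, apartmentVector_union h.disjoint_foldAt]

theorem apartmentVector_hyperplane (h : IsMeridian L A B H) :
    apartmentVector (L.foldAt L) + apartmentVector (L.foldAt H) = 0 := by
  rw [h.foldAt_hyperplane, apartmentVector_add_compl]

theorem exists_geodesic_from_line (h : IsMeridian L A B H) :
    ∃ γ a b, Building.IsThreeEdgeGeodesic γ L A B H a b :=
  L.isFold_foldAt.exists_isThreeEdgeGeodesic h.adjacent_line_sup h.adjacent_sup
    h.adjacent_hyperplane h.apartmentVector_sup.symm h.apartmentVector_hyperplane

theorem exists_geodesic_from_hyperplane (h : IsMeridian L A B H) :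
    ∃ γ a b, Building.IsThreeEdgeGeodesic γ H B A L a b := by
  refine L.isFold_foldAt.exists_isThreeEdgeGeodesic h.adjacent_hyperplane.symm h.adjacent_sup.symm
    h.adjacent_line_sup.symm ?_ ?_
  · rw [h.apartmentVector_sup, ← add_assoc, add_comm (apartmentVector (L.foldAt H)),
      h.apartmentVector_hyperplane, zero_add]
  · rw [add_comm, h.apartmentVector_hyperplane]

end IsMeridian

/-! ## Lines and hyperplanes -/

section LineHyperplane

open Submodule

variable {K V : Type*} [Field K] [AddCommGroup V] [Module K V] {p : Submodule K V}
  {g : Module.Dual K V} {x : V}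

theorem isCompl_span_singleton_ker (hgx : g x ≠ 0) : IsCompl (span K {x}) (LinearMap.ker g) := by
  refine ⟨disjoint_def.mpr fun y hy hgy => ?_,
    codisjoint_iff.mpr (LinearMap.span_singleton_sup_ker_eq_top g hgx)⟩
  obtain ⟨c, rfl⟩ := mem_span_singleton.mp hy
  have hc : c * g x = 0 := by simpa using hgy
  rw [(mul_eq_zero.mp hc).resolve_right hgx, zero_smul]

theorem span_singleton_sup_inf_ker (hx : x ∈ p) (hgx : g x ≠ 0) :
    span K {x} ⊔ p ⊓ LinearMap.ker g = p := by
  rw [inf_comm, ← sup_inf_assoc_of_le _ ((span_singleton_le_iff_mem x p).mpr hx),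
    (isCompl_span_singleton_ker hgx).sup_eq_top, top_inf_eq]

theorem span_singleton_sup_inf_ker_of_le (hp : p ≤ LinearMap.ker g) (hgx : g x ≠ 0) :
    (span K {x} ⊔ p) ⊓ LinearMap.ker g = p := by
  rw [sup_comm, sup_inf_assoc_of_le _ hp, (isCompl_span_singleton_ker hgx).inf_eq_bot, sup_bot_eq]

end LineHyperplane

/-! ## Edge vectors -/

theorem zmodTwo_eq_one_of_ne_zero {s : ZMod 2} (hs : s ≠ 0) : s = 1 :=
  Fin.eq_one_of_ne_zero s hs

theorem zmodTwo_add_eq_of_ne {s t u : ZMod 2} (hst : s ≠ t) (hu : u ≠ 0) : s + u = t := by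
  decide +revert

variable {n : ℕ}

/-- The vector `eᵢ + eⱼ` that spans the rank one subspace of the edge `(i, j)` of the `n`-gon. -/
def edgeVector (i j : Fin n) : FTwoSpace n :=
  edgeBasisVector n i + edgeBasisVector n j

theorem edgeVector_self (i : Fin n) : edgeVector i i = 0 :=
  FTwoSpace.add_self _

theorem edgeVector_comm (i j : Fin n) : edgeVector i j = edgeVector j i :=
  add_comm _ _

theorem edgeVector_add_edgeVector (i j k : Fin n) :
    edgeVector i j + edgeVector j k = edgeVector i k := by
  rw [edgeVector, edgeVector, edgeVector, add_assoc, ← add_assoc (edgeBasisVector n j),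
    FTwoSpace.add_self, zero_add]

/-- The functional that counts modulo 2 the edges at the label `i` in a sum of edge vectors. -/
def labelParity (i : Fin n) : Module.Dual (ZMod 2) (FTwoSpace n) :=
  if h : (i : ℕ) < n - 1 then LinearMap.proj ⟨i, h⟩ else ∑ k, LinearMap.proj k

theorem labelParity_edgeBasisVector (i j : Fin n) :
    labelParity i (edgeBasisVector n j)
      = (if i = j then 1 else 0) + if (i : ℕ) < n - 1 then 0 else 1 := by
  unfold labelParity
  split_ifs with hi hij hij
  · simp [edgeBasisVector, hij]
  · simp [edgeBasisVector, Fin.val_inj, hij]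
  · have hj : ∀ k : Fin (n - 1), (k : ℕ) ≠ j := fun k hk => hi (by rw [hij, ← hk]; exact k.2)
    simp [edgeBasisVector, hj, CharTwo.add_self_eq_zero]
  · have hj : (j : ℕ) < n - 1 := by
      have := Fin.val_ne_of_ne hij
      omega
    have hk : ∀ k : Fin (n - 1), (k : ℕ) = j ↔ k = ⟨j, hj⟩ := fun k => by simp [Fin.ext_iff]
    simp [edgeBasisVector, hk]

theorem labelParity_edgeVector (i j k : Fin n) :
    labelParity i (edgeVector j k) = (if i = j then 1 else 0) + if i = k then 1 else 0 := by
  rw [edgeVector, map_add, labelParity_edgeBasisVector, labelParity_edgeBasisVector,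
    add_add_add_comm, CharTwo.add_self_eq_zero (if (i : ℕ) < n - 1 then (0 : ZMod 2) else 1),
    add_zero]

theorem exists_labelParity_ne_zero {v : FTwoSpace n} (hv : v ≠ 0) : ∃ i, labelParity i v ≠ 0 := by
  obtain ⟨k, hk⟩ := Function.ne_iff.mp hv
  exact ⟨⟨k, by omega⟩, by simpa [labelParity] using hk⟩

theorem exists_apply_edgeVector_ne_zero {g : Module.Dual (ZMod 2) (FTwoSpace n)} (hg : g ≠ 0) :
    ∃ i j, g (edgeVector i j) ≠ 0 := by
  by_contra! hg'
  refine hg (LinearMap.pi_ext' fun k => LinearMap.ext_ring ?_)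
  have hsingle : (Pi.single k 1 : FTwoSpace n)
      = edgeVector (⟨k, by have := k.2; omega⟩ : Fin n) ⟨n - 1, by have := k.2; omega⟩ := by
    funext l
    simp [edgeVector, edgeBasisVector, Pi.single_apply, Fin.ext_iff, l.2.ne]
  simpa [hsingle] using hg' _ _

theorem edgeVector_ne_zero {i j : Fin n} (hij : i ≠ j) : edgeVector i j ≠ 0 := fun h => by
  have := labelParity_edgeVector i i j
  simp [h, hij] at this

/-- A vector that spans the subspace of an edge, or zero. -/
def IsEdgeVector (v : FTwoSpace n) : Prop :=
  ∃ i j, v = edgeVector i j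

theorem not_isEdgeVector_add {i j k l : Fin n} (h : [i, j, k, l].Nodup) :
    ¬ IsEdgeVector (edgeVector i j + edgeVector k l) := by
  rintro ⟨r, s, hrs⟩
  have mem_of_ne_zero : ∀ m, labelParity m (edgeVector i j + edgeVector k l) ≠ 0 →
      m = r ∨ m = s := fun m hm => by
    rw [hrs, labelParity_edgeVector] at hm
    by_contra! hm'
    simp [hm'] at hm
  simp only [List.nodup_cons, List.mem_cons, List.not_mem_nil, or_false, not_or] at h
  have hi := mem_of_ne_zero i (by simp [labelParity_edgeVector, h])
  have hj := mem_of_ne_zero j (by simp [labelParity_edgeVector, h, Ne.symm h.1.1])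
  have hk := mem_of_ne_zero k
    (by simp [labelParity_edgeVector, h, Ne.symm h.1.2.1, Ne.symm h.2.1.1])
  grind

theorem exists_not_isEdgeVector_apply_ne_zero (hn : 5 ≤ n) {g : Module.Dual (ZMod 2) (FTwoSpace n)}
    (hg : g ≠ 0) : ∃ x, ¬ IsEdgeVector x ∧ g x ≠ 0 := by
  obtain ⟨i, j, hij⟩ := exists_apply_edgeVector_ne_zero hg
  have hne : i ≠ j := fun h => hij (by rw [h, edgeVector_self, map_zero])
  have hcard : 2 < ({i, j}ᶜ : Finset (Fin n)).card := by
    rw [Finset.card_compl, Finset.card_pair hne, Fintype.card_fin]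
    omega
  obtain ⟨a, b, c, ha, hb, hc, hab, hac, hbc⟩ := Finset.two_lt_card_iff.mp hcard
  simp only [Finset.mem_compl, Finset.mem_insert, Finset.mem_singleton, not_or] at ha hb hc
  by_contra! hzero
  have hi := hzero (edgeVector i a + edgeVector b c) (not_isEdgeVector_add (by grind))
  have hj := hzero (edgeVector j a + edgeVector b c) (not_isEdgeVector_add (by grind))
  refine hij ?_
  rw [← edgeVector_add_edgeVector i a j, edgeVector_comm a j,
    ← add_zero (edgeVector i a + edgeVector j a), ← FTwoSpace.add_self (edgeVector b c),
    add_add_add_comm, map_add, hi, hj, add_zero]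

/-! ## Subspaces of non-crossing partitions -/

section NonCrossing

open Submodule

variable {U W : Submodule (ZMod 2) (FTwoSpace n)} {f g : Module.Dual (ZMod 2) (FTwoSpace n)}
  {x y : FTwoSpace n} {a b c d : Fin n}

theorem partitionSubspace_le_iff {P : Setoid (Fin n)} :
    partitionSubspace P ≤ U ↔ ∀ i j, P i j → edgeVector i j ∈ U := by
  simp only [partitionSubspace, edgeSubspace, iSup_le_iff, span_singleton_le_iff_mem, and_imp]
  refine ⟨fun h i j hP => ?_, fun h i j _ hP => h i j hP⟩
  rcases lt_trichotomy i j with hij | rfl | hij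
  · exact h i j hij hP
  · rw [edgeVector_self]
    exact U.zero_mem
  · rw [edgeVector_comm]
    exact h j i hij (P.symm hP)

/-- The partition in which two labels lie in a common block if `U` contains their edge vector. -/
def edgeSetoid (U : Submodule (ZMod 2) (FTwoSpace n)) : Setoid (Fin n) where
  r i j := edgeVector i j ∈ U
  iseqv :=
    { refl := fun i => by rw [edgeVector_self]; exact U.zero_mem
      symm := fun h => by rwa [edgeVector_comm]
      trans := fun h h' => by rw [← edgeVector_add_edgeVector]; exact U.add_mem h h' }

theorem partitionSubspace_edgeSetoid_le : partitionSubspace (edgeSetoid U) ≤ U :=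
  partitionSubspace_le_iff.mpr fun _ _ h => h

open Classical in
theorem edgeSetoid_partitionSubspace (P : Setoid (Fin n)) :
    edgeSetoid (partitionSubspace P) = P := by
  ext i j
  refine ⟨fun hmem => ?_, partitionSubspace_le_iff.mp le_rfl i j⟩
  by_contra hij
  let f : Module.Dual (ZMod 2) (FTwoSpace n) := ∑ k with P i k, labelParity k
  have hf : ∀ k l, f (edgeVector k l) = (if P i k then 1 else 0) + if P i l then 1 else 0 :=
    fun k l => by simp [f, labelParity_edgeVector, Finset.sum_add_distrib]
  have hle : partitionSubspace P ≤ LinearMap.ker f := partitionSubspace_le_iff.mpr fun k l hkl => by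
    have hiff : P i k ↔ P i l := ⟨fun h => P.trans h hkl, fun h => P.trans h (P.symm hkl)⟩
    rw [LinearMap.mem_ker, hf, hiff, CharTwo.add_self_eq_zero]
  have : f (edgeVector i j) = 0 := hle hmem
  rw [hf, if_pos (P.refl i), if_neg hij] at this
  simp at this

/-- A subspace that represents a non-crossing partition; in contrast to `BuildingVertex.IsNCP`, the
subspaces `⊥` and `⊤` are allowed. -/
def IsNCPSubspace (U : Submodule (ZMod 2) (FTwoSpace n)) : Prop :=
  ∃ P : Setoid (Fin n), IsNonCrossing P ∧ partitionSubspace P = U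

theorem isNCPSubspace_iff :
    IsNCPSubspace U ↔ IsNonCrossing (edgeSetoid U) ∧ partitionSubspace (edgeSetoid U) = U := by
  refine ⟨?_, fun h => ⟨_, h⟩⟩
  rintro ⟨P, hP, rfl⟩
  rw [edgeSetoid_partitionSubspace]
  exact ⟨hP, rfl⟩

/-- The edges `(a, c)` and `(b, d)` of the `n`-gon cross, and `U` contains their edge vectors
without joining them to one block. -/
structure CrossesAt (U : Submodule (ZMod 2) (FTwoSpace n)) (a b c d : Fin n) : Prop where
  lt₁ : a < b
  lt₂ : b < c
  lt₃ : c < d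
  mem₁ : edgeVector a c ∈ U
  mem₂ : edgeVector b d ∈ U
  notMem : edgeVector a b ∉ U

theorem CrossesAt.of_le (h : CrossesAt U a b c d) (hUW : U ≤ W) (hab : edgeVector a b ∉ W) :
    CrossesAt W a b c d :=
  ⟨h.lt₁, h.lt₂, h.lt₃, hUW h.mem₁, hUW h.mem₂, hab⟩

theorem CrossesAt.not_isNCPSubspace (h : CrossesAt U a b c d) : ¬ IsNCPSubspace U := fun hU =>
  (isNCPSubspace_iff.mp hU).1 ⟨a, b, c, d, h.lt₁, h.lt₂, h.lt₃, h.mem₁, h.mem₂, h.notMem⟩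

theorem not_isNCPSubspace_of_dual (hf : ∀ i j, edgeVector i j ∈ U → f (edgeVector i j) = 0)
    (hy : y ∈ U) (hfy : f y ≠ 0) : ¬ IsNCPSubspace U := fun hU => by
  rw [← (isNCPSubspace_iff.mp hU).2] at hy
  exact hfy ((partitionSubspace_le_iff (U := LinearMap.ker f)).mpr hf hy)

theorem exists_crossesAt_or_exists_dual (hU : ¬ IsNCPSubspace U) :
    (∃ a b c d, CrossesAt U a b c d) ∨
      ∃ f : Module.Dual (ZMod 2) (FTwoSpace n), ∃ y ∈ U,
        f y ≠ 0 ∧ ∀ i j, edgeVector i j ∈ U → f (edgeVector i j) = 0 := by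
  by_cases hcross : IsNonCrossing (edgeSetoid U)
  · have hlt : ¬ U ≤ partitionSubspace (edgeSetoid U) := fun hle =>
      hU (isNCPSubspace_iff.mpr ⟨hcross, partitionSubspace_edgeSetoid_le.antisymm hle⟩)
    obtain ⟨y, hyU, hy⟩ := SetLike.not_le_iff_exists.mp hlt
    obtain ⟨f, hfy, hf⟩ := exists_le_ker_of_notMem (K := ZMod 2) hy
    exact .inr ⟨f, y, hyU, hfy, partitionSubspace_le_iff.mp hf⟩
  · obtain ⟨a, b, c, d, hab, hbc, hcd, hac, hbd, hnot⟩ := not_not.mp hcross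
    exact .inl ⟨a, b, c, d, hab, hbc, hcd, hac, hbd, hnot⟩

theorem isNCPSubspace_bot : IsNCPSubspace (⊥ : Submodule (ZMod 2) (FTwoSpace n)) := by
  by_contra h
  obtain ⟨a, b, c, d, h⟩ | ⟨f, y, hy, hfy, -⟩ := exists_crossesAt_or_exists_dual h
  · exact edgeVector_ne_zero (h.lt₁.trans h.lt₂).ne h.mem₁
  · exact hfy (by rw [(mem_bot _).mp hy, map_zero])

theorem isNCPSubspace_top : IsNCPSubspace (⊤ : Submodule (ZMod 2) (FTwoSpace n)) := by
  by_contra h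
  obtain ⟨a, b, c, d, h⟩ | ⟨f, y, -, hfy, hf⟩ := exists_crossesAt_or_exists_dual h
  · exact h.notMem mem_top
  · obtain ⟨i, j, hij⟩ := exists_apply_edgeVector_ne_zero fun h : f = 0 => hfy (by simp [h])
    exact hij (hf i j mem_top)

theorem not_isNCPSubspace_span_pair (hx : ¬ IsEdgeVector x) (hy : ¬ IsEdgeVector y)
    (hfx : f x ≠ 0) (hfy : f y ≠ 0) : ¬ IsNCPSubspace (span (ZMod 2) {x, y}) := by
  refine not_isNCPSubspace_of_dual (f := f) (fun i j hij => ?_)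
    (subset_span (Set.mem_insert x {y})) hfx
  obtain ⟨s, t, hst⟩ := mem_span_pair.mp hij
  rw [← hst, map_add, map_smul, map_smul, zmodTwo_eq_one_of_ne_zero hfx,
    zmodTwo_eq_one_of_ne_zero hfy]
  by_cases hs : s = 0 <;> by_cases ht : t = 0
  · simp [hs, ht]
  · exact absurd ⟨i, j, by simpa [hs, zmodTwo_eq_one_of_ne_zero ht] using hst⟩ hy
  · exact absurd ⟨i, j, by simpa [ht, zmodTwo_eq_one_of_ne_zero hs] using hst⟩ hx
  · rw [zmodTwo_eq_one_of_ne_zero hs, zmodTwo_eq_one_of_ne_zero ht, CharTwo.add_self_eq_zero]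

theorem not_isNCPSubspace_span_singleton (hx : ¬ IsEdgeVector x) (hfx : f x ≠ 0) :
    ¬ IsNCPSubspace (span (ZMod 2) {x}) := by
  simpa using not_isNCPSubspace_span_pair hx hx hfx hfx

end NonCrossing

/-! ## Crossing hyperplanes -/

section CrossingHyperplane

variable {g : Module.Dual (ZMod 2) (FTwoSpace n)} {a b c d : Fin n}

theorem crossesAt_ker_labelParity_add (hab : a < b) (hbc : b < c) (hcd : c < d) :
    CrossesAt (LinearMap.ker (labelParity a + labelParity c)) a b c d := by
  have hac := hab.trans hbc
  refine ⟨hab, hbc, hcd, ?_, ?_, ?_⟩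
  · simp [labelParity_edgeVector, hac.ne, hac.ne', CharTwo.add_self_eq_zero]
  · simp [labelParity_edgeVector, hab.ne, (hac.trans hcd).ne, hbc.ne', hcd.ne]
  · simp [labelParity_edgeVector, hab.ne, hac.ne', hbc.ne']

theorem CrossesAt.add_labelParity (h : CrossesAt (LinearMap.ker g) a b c d) {i : Fin n}
    (hi : i ∉ ({a, b, c, d} : Finset (Fin n))) :
    CrossesAt (LinearMap.ker (g + labelParity i)) a b c d := by
  simp only [Finset.mem_insert, Finset.mem_singleton, not_or] at hi
  refine ⟨h.lt₁, h.lt₂, h.lt₃, ?_, ?_, ?_⟩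
  · simpa [labelParity_edgeVector, hi] using h.mem₁
  · simpa [labelParity_edgeVector, hi] using h.mem₂
  · simpa [labelParity_edgeVector, hi] using h.notMem

theorem exists_crossesAt_ker_apply_eq (hn : 5 ≤ n) {z : FTwoSpace n} (hz : z ≠ 0) (t : ZMod 2) :
    ∃ (g : Module.Dual (ZMod 2) (FTwoSpace n)) (a b c d : Fin n),
      CrossesAt (LinearMap.ker g) a b c d ∧ g z = t := by
  obtain ⟨i, hi⟩ := exists_labelParity_ne_zero hz
  have hcard : 4 ≤ ({i}ᶜ : Finset (Fin n)).card := by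
    rw [Finset.card_compl, Finset.card_singleton, Fintype.card_fin]
    omega
  let e := Finset.orderEmbOfCardLe _ hcard
  have he : ∀ k, e k ≠ i := fun k => by
    simpa using Finset.orderEmbOfCardLe_mem _ hcard k
  have hcross := crossesAt_ker_labelParity_add (e.lt_iff_lt.mpr (by decide : (0 : Fin 4) < 1))
    (e.lt_iff_lt.mpr (by decide : (1 : Fin 4) < 2)) (e.lt_iff_lt.mpr (by decide : (2 : Fin 4) < 3))
  by_cases ht : (labelParity (e 0) + labelParity (e 2)) z = t
  · exact ⟨_, _, _, _, _, hcross, ht⟩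
  · refine ⟨_, _, _, _, _, hcross.add_labelParity (i := i) (by simp [(he _).symm]), ?_⟩
    exact zmodTwo_add_eq_of_ne ht hi

end CrossingHyperplane

/-! ## Meridians that avoid the non-crossing partitions -/

section NCPFreeMeridian

open Submodule

variable {U : Submodule (ZMod 2) (FTwoSpace n)} {f g : Module.Dual (ZMod 2) (FTwoSpace n)}
  {x y z : FTwoSpace n} {a b c d : Fin n}

/-- The subspace `U` is one of the two inner vertices of a meridian, none of whose vertices is a
non-crossing partition. -/
def LiesOnNCPFreeMeridian (U : Submodule (ZMod 2) (FTwoSpace n)) : Prop :=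
  ∃ L A B H : BuildingVertex n, IsMeridian L A B H ∧
    (¬ L.IsNCP ∧ ¬ A.IsNCP ∧ ¬ B.IsNCP ∧ ¬ H.IsNCP) ∧ (A.1 = U ∨ B.1 = U)

theorem exists_isMeridian_not_isNCP {A B : Submodule (ZMod 2) (FTwoSpace n)} (hx : ¬ IsEdgeVector x)
    (hg : CrossesAt (LinearMap.ker g) a b c d) (hgx : g x ≠ 0) (hA : ¬ IsNCPSubspace A)
    (hB : ¬ IsNCPSubspace B) (hBg : B ≤ LinearMap.ker g) (hxB : span (ZMod 2) {x} ⊔ B = A) :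
    ∃ L A' B' H : BuildingVertex n, IsMeridian L A' B' H ∧
      (¬ L.IsNCP ∧ ¬ A'.IsNCP ∧ ¬ B'.IsNCP ∧ ¬ H.IsNCP) ∧ A'.1 = A ∧ B'.1 = B := by
  have proper {W : Submodule (ZMod 2) (FTwoSpace n)} (hW : ¬ IsNCPSubspace W) : W ≠ ⊥ ∧ W ≠ ⊤ :=
    ⟨fun h => hW (h ▸ isNCPSubspace_bot), fun h => hW (h ▸ isNCPSubspace_top)⟩
  have hL := not_isNCPSubspace_span_singleton hx hgx
  have hH := hg.not_isNCPSubspace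
  have hrank := finrank_span_singleton (K := ZMod 2) fun h : x = 0 => hgx (by rw [h, map_zero])
  exact ⟨⟨_, proper hL⟩, ⟨A, proper hA⟩, ⟨B, proper hB⟩, ⟨_, proper hH⟩,
    ⟨hrank, isCompl_span_singleton_ker hgx, hBg, hxB⟩, ⟨hL, hA, hB, hH⟩, rfl, rfl⟩

theorem liesOnNCPFreeMeridian_of_mem (hx : ¬ IsEdgeVector x)
    (hg : CrossesAt (LinearMap.ker g) a b c d) (hgx : g x ≠ 0) (hxU : x ∈ U)
    (hU : ¬ IsNCPSubspace U) (hUg : ¬ IsNCPSubspace (U ⊓ LinearMap.ker g)) :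
    LiesOnNCPFreeMeridian U := by
  obtain ⟨L, A, B, H, hmeridian, hncp, hA, -⟩ := exists_isMeridian_not_isNCP hx hg hgx hU hUg
    inf_le_right (span_singleton_sup_inf_ker hxU hgx)
  exact ⟨L, A, B, H, hmeridian, hncp, .inl hA⟩

theorem liesOnNCPFreeMeridian_of_le (hx : ¬ IsEdgeVector x)
    (hg : CrossesAt (LinearMap.ker g) a b c d) (hgx : g x ≠ 0) (hUg : U ≤ LinearMap.ker g)
    (hU : ¬ IsNCPSubspace U) (hxU : ¬ IsNCPSubspace (span (ZMod 2) {x} ⊔ U)) :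
    LiesOnNCPFreeMeridian U := by
  obtain ⟨L, A, B, H, hmeridian, hncp, -, hB⟩ := exists_isMeridian_not_isNCP hx hg hgx hxU hU hUg
    rfl
  exact ⟨L, A, B, H, hmeridian, hncp, .inr hB⟩

theorem liesOnNCPFreeMeridian_of_dual (hn : 5 ≤ n)
    (hf : ∀ i j, edgeVector i j ∈ U → f (edgeVector i j) = 0) (hyU : y ∈ U) (hfy : f y ≠ 0)
    (hzU : z ∈ U) (hfz : f z = 0) (hz : z ≠ 0) : LiesOnNCPFreeMeridian U := by
  obtain ⟨g, a, b, c, d, hg, hgz⟩ := exists_crossesAt_ker_apply_eq hn hz 1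
  suffices ∃ y₀ ∈ U, ∃ y₁ ∈ U, g y₀ = 0 ∧ g y₁ ≠ 0 ∧ f y₀ ≠ 0 ∧ f y₁ ≠ 0 by
    obtain ⟨y₀, hy₀U, y₁, hy₁U, hgy₀, hgy₁, hfy₀, hfy₁⟩ := this
    refine liesOnNCPFreeMeridian_of_mem (x := y₁) ?_ hg hgy₁ hy₁U
      (not_isNCPSubspace_of_dual hf hyU hfy)
      (not_isNCPSubspace_of_dual (fun i j hij => hf i j hij.1) ⟨hy₀U, hgy₀⟩ hfy₀)
    rintro ⟨i, j, rfl⟩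
    exact hfy₁ (hf i j hy₁U)
  have hfyz : f (y + z) ≠ 0 := by rwa [map_add, hfz, add_zero]
  have hgyz : g (y + z) = g y + 1 := by rw [map_add, hgz]
  by_cases hgy : g y = 0
  · exact ⟨y, hyU, y + z, U.add_mem hyU hzU, hgy, by simp [hgyz, hgy], hfy, hfyz⟩
  · exact ⟨y + z, U.add_mem hyU hzU, y, hyU,
      hgyz.trans (zmodTwo_add_eq_of_ne hgy one_ne_zero), hgy, hfyz, hfy⟩

theorem liesOnNCPFreeMeridian_span_singleton (hn : 5 ≤ n) (hy : ¬ IsEdgeVector y) (hfy : f y ≠ 0) :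
    LiesOnNCPFreeMeridian (span (ZMod 2) {y}) := by
  have hy₀ : y ≠ 0 := fun h => hfy (by rw [h, map_zero])
  obtain ⟨g, a, b, c, d, hg, hgy⟩ := exists_crossesAt_ker_apply_eq hn hy₀ 0
  have hg₀ : g ≠ 0 := fun h => hg.notMem (by simp [h])
  obtain ⟨x, hx, hgx⟩ := exists_not_isEdgeVector_apply_ne_zero hn hg₀
  obtain ⟨f', hfx', hfy'⟩ : ∃ f' : Module.Dual (ZMod 2) (FTwoSpace n), f' x ≠ 0 ∧ f' y ≠ 0 := by
    by_cases hfx : f x = 0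
    · exact ⟨f + g, by simpa [hfx], by simpa [hgy]⟩
    · exact ⟨f, hfx, hfy⟩
  refine liesOnNCPFreeMeridian_of_le hx hg hgx ((span_singleton_le_iff_mem _ _).mpr hgy)
    (not_isNCPSubspace_span_singleton hy hfy) ?_
  rw [← span_insert]
  exact not_isNCPSubspace_span_pair hx hy hfx' hfy'

theorem CrossesAt.liesOnNCPFreeMeridian_of_sup_ne_top (hn : 5 ≤ n) (hU : CrossesAt U a b c d)
    (hne : span (ZMod 2) {edgeVector a b} ⊔ U ≠ ⊤) : LiesOnNCPFreeMeridian U := by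
  obtain ⟨h, hh₀, hh⟩ := exists_le_ker_of_lt_top _ hne.lt_top
  obtain ⟨hhab, hhU⟩ := sup_le_iff.mp hh
  rw [span_singleton_le_iff_mem, LinearMap.mem_ker] at hhab
  obtain ⟨x, hx, hhx⟩ := exists_not_isEdgeVector_apply_ne_zero hn hh₀
  obtain ⟨g, hgx, hgab, hgU⟩ : ∃ g : Module.Dual (ZMod 2) (FTwoSpace n),
      g x ≠ 0 ∧ g (edgeVector a b) ≠ 0 ∧ U ≤ LinearMap.ker g := by
    obtain ⟨g, hgab, hgU⟩ := exists_le_ker_of_notMem (K := ZMod 2) hU.notMem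
    by_cases hgx : g x = 0
    · exact ⟨g + h, by simpa [hgx], by simpa [hhab], fun u hu => by
        simp [LinearMap.mem_ker.mp (hgU hu), LinearMap.mem_ker.mp (hhU hu)]⟩
    · exact ⟨g, hgx, hgab, hgU⟩
  refine liesOnNCPFreeMeridian_of_le hx (hU.of_le hgU hgab) hgx hgU hU.not_isNCPSubspace
    (hU.of_le le_sup_right fun hab => hU.notMem ?_).not_isNCPSubspace
  rw [← span_singleton_sup_inf_ker_of_le hhU hhx]
  exact ⟨hab, hhab⟩

theorem CrossesAt.liesOnNCPFreeMeridian_ker (hn : 5 ≤ n)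
    (hg : CrossesAt (LinearMap.ker g) a b c d) : LiesOnNCPFreeMeridian (LinearMap.ker g) := by
  obtain ⟨i, hi⟩ : ∃ i, i ∉ ({a, b, c, d} : Finset (Fin n)) := by
    by_contra! hall
    have := (Finset.card_le_card fun i _ => hall i : (Finset.univ : Finset (Fin n)).card ≤ _).trans
      Finset.card_le_four
    rw [Finset.card_univ, Fintype.card_fin] at this
    omega
  have hi' := hi
  simp only [Finset.mem_insert, Finset.mem_singleton, not_or] at hi'
  have := hg.lt₁
  have := hg.lt₂
  have := hg.lt₃
  obtain ⟨x, hx, hgx, hix⟩ : ∃ x, ¬ IsEdgeVector x ∧ g x = 0 ∧ labelParity i x ≠ 0 := by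
    by_cases hia : g (edgeVector i a) = 0
    · refine ⟨edgeVector i a + edgeVector b d, not_isEdgeVector_add (by grind), ?_,
        by simp [labelParity_edgeVector, hi']⟩
      rw [map_add, hia, hg.mem₂, add_zero]
    · have hib : g (edgeVector i b) = 0 := by
        rw [← edgeVector_add_edgeVector i a b, map_add]
        exact zmodTwo_add_eq_of_ne hia hg.notMem
      refine ⟨edgeVector i b + edgeVector a c, not_isEdgeVector_add (by grind), ?_,
        by simp [labelParity_edgeVector, hi']⟩
      rw [map_add, hib, hg.mem₁, add_zero]
  have hg' := hg.add_labelParity hi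
  have hinf : CrossesAt (LinearMap.ker g ⊓ LinearMap.ker (g + labelParity i)) a b c d :=
    ⟨hg.lt₁, hg.lt₂, hg.lt₃, ⟨hg.mem₁, hg'.mem₁⟩, ⟨hg.mem₂, hg'.mem₂⟩, fun h => hg.notMem h.1⟩
  exact liesOnNCPFreeMeridian_of_mem hx hg' (by simpa [hgx]) hgx hg.not_isNCPSubspace
    hinf.not_isNCPSubspace

theorem liesOnNCPFreeMeridian_of_not_isNCPSubspace (hn : 5 ≤ n) (hU : ¬ IsNCPSubspace U) :
    LiesOnNCPFreeMeridian U := by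
  obtain ⟨a, b, c, d, hcross⟩ | ⟨f, y, hyU, hfy, hf⟩ := exists_crossesAt_or_exists_dual hU
  · by_cases htop : span (ZMod 2) {edgeVector a b} ⊔ U = ⊤
    · obtain ⟨g, hgab, hgU⟩ := exists_le_ker_of_notMem (K := ZMod 2) hcross.notMem
      obtain rfl : LinearMap.ker g = U := by
        rw [← top_inf_eq (LinearMap.ker g), ← htop, span_singleton_sup_inf_ker_of_le hgU hgab]
      exact hcross.liesOnNCPFreeMeridian_ker hn
    · exact hcross.liesOnNCPFreeMeridian_of_sup_ne_top hn htop
  · by_cases hbot : U ⊓ LinearMap.ker f = ⊥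
    · obtain rfl : span (ZMod 2) {y} = U := by
        rw [← span_singleton_sup_inf_ker hyU hfy, hbot, sup_bot_eq]
      exact liesOnNCPFreeMeridian_span_singleton hn
        (by rintro ⟨i, j, rfl⟩; exact hfy (hf i j hyU)) hfy
    · obtain ⟨z, ⟨hzU, hfz⟩, hz⟩ := exists_mem_ne_zero_of_ne_bot hbot
      exact liesOnNCPFreeMeridian_of_dual hn hf hyU hfy hzU hfz hz

end NCPFreeMeridian

theorem mainTheorem10 (n : ℕ) (hn : 5 ≤ n) (p : BuildingVertex n) (hp : ¬ p.IsNCP) :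
    ∃ (γ : ℝ → Building n) (p_u q p_v : BuildingVertex n) (a b : ℝ),
      Building.IsGeodesic γ Real.pi ∧
      Building.ofVertex p ∈ γ '' Set.Icc 0 Real.pi ∧
      Disjoint (γ '' Set.Icc 0 Real.pi) (Building.ncp n) ∧
      p_u.Adjacent p ∧ p.Adjacent q ∧ q.Adjacent p_v ∧
      0 < a ∧ a < b ∧ b < Real.pi ∧
      γ 0 = Building.ofVertex p_u ∧ γ a = Building.ofVertex p ∧
      γ b = Building.ofVertex q ∧ γ Real.pi = Building.ofVertex p_v ∧
      γ '' Set.Icc 0 a = Building.edge p_u p ∧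
      γ '' Set.Icc a b = Building.edge p q ∧
      γ '' Set.Icc b Real.pi = Building.edge q p_v := by
  suffices ∃ γ p_u q p_v a b, Building.IsThreeEdgeGeodesic γ p_u p q p_v a b ∧
      (¬ p_u.IsNCP ∧ ¬ q.IsNCP ∧ ¬ p_v.IsNCP) ∧
      p_u.Adjacent p ∧ p.Adjacent q ∧ q.Adjacent p_v by
    obtain ⟨γ, p_u, q, p_v, a, b, h, ⟨hu, hq, hv⟩, hup, hpq, hqv⟩ := this
    exact ⟨γ, p_u, q, p_v, a, b, h.isGeodesic, h.ofVertex_mem_image, h.disjoint_ncp hu hp hq hv,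
      hup, hpq, hqv, h.pos, h.lt, h.lt_pi, h.map_zero, h.map_left, h.map_right, h.map_pi,
      h.image_first, h.image_second, h.image_third⟩
  obtain ⟨L, A, B, H, h, ⟨hL, hA, hB, hH⟩, hAp | hBp⟩ :=
    liesOnNCPFreeMeridian_of_not_isNCPSubspace hn hp
  · obtain rfl : A = p := Subtype.ext hAp
    obtain ⟨γ, a, b, hγ⟩ := h.exists_geodesic_from_line
    exact ⟨γ, L, B, H, a, b, hγ, ⟨hL, hB, hH⟩, h.adjacent_line_sup, h.adjacent_sup,
      h.adjacent_hyperplane⟩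
  · obtain rfl : B = p := Subtype.ext hBp
    obtain ⟨γ, a, b, hγ⟩ := h.exists_geodesic_from_hyperplane
    exact ⟨γ, H, A, L, a, b, hγ, ⟨hH, hA, hL⟩, h.adjacent_hyperplane.symm, h.adjacent_sup.symm,
      h.adjacent_line_sup.symm⟩
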